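/- Let $\mathcal P_3=\{(\theta_1,\theta_2,\theta_3)\in\mathbb R^3 : \theta_1,\theta_2,\theta_3>0,\ \theta_1+\theta_2+\theta_3=1\}$, a $2$-dimensional smooth manifold. For $\alpha\in\mathbb R$ let $g_\alpha$ be the Riemannian metric on $\mathcal P_3$ that is the pull-back of the Euclidean metric of $\mathbb R^3$ under the map $\phi_\alpha:\mathcal P_3\to\mathbb R^3$, $$\phi_\alpha(\theta)=\begin{cases}\frac{2}{1-\alpha}\left(\theta_1^{\frac{1-\alpha}{2}},\theta_2^{\frac{1-\alpha}{2}},\theta_3^{\frac{1-\alpha}{2}}\right), & \alpha\neq 1,\\ (\log\theta_1,\log\theta_2,\log\theta_3), & \alpha=1.\end{cases}$$ Then for every $\alpha\in\mathbb R$ and every $\theta=(\theta_1,\theta_2,\theta_3)\in\mathcal P_3$ the scalar curvature of $(\mathcal P_3,g_\alpha)$ at $\theta$ (the full trace $\sum_{t,s}g_\alpha(R(A_t,A_s)A_s,A_t)$ over a $g_\alpha$-orthonormal basis $(A_t)$ of the tangent space at $\theta$, with $R(X,Y)=[\nabla_X,\nabla_Y]-\nabla_{[X,Y]}$ for the Levi-Civita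 connection $\nabla$, i.e. twice the Gaussian curvature) is $$\mathrm{Scal}(\theta)=\frac{(1+\alpha)^2}{2}\,\frac{\theta_1^{\alpha}\theta_2^{\alpha}\theta_3^{\alpha}}{\left(\theta_1^{\alpha+1}+\theta_2^{\alpha+1}+\theta_3^{\alpha+1}\right)^2}.$$ -/

import Mathlib

noncomputable section

namespace RiemannCoord

/-- The partial derivative `∂ᵢ F` of a map defined on (an open subset of) `ℝᵐ`. -/
def pderiv {m : ℕ} {E : Type*} [NormedAddCommGroup E] [NormedSpace ℝ E]
    (i : Fin m) (F : (Fin m → ℝ) → E) (x : Fin m → ℝ) : E :=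
  fderiv ℝ F x (Pi.single i 1)

/-- The coefficient matrix `g_{ij} = ⟨∂ᵢ F, ∂ⱼ F⟩` of the pull-back along `F : ℝᵐ → ℝⁿ` of the
canonical metric `g_c(u, v) = ∑ₖ uₖ vₖ` of `ℝⁿ`. -/
def pullbackMetric {m n : ℕ} (F : (Fin m → ℝ) → (Fin n → ℝ)) (x : Fin m → ℝ) :
    Matrix (Fin m) (Fin m) ℝ :=
  Matrix.of fun i j => ∑ k, pderiv i F x k * pderiv j F x k

/-- The Christoffel symbol `Γᵏᵢⱼ` of the Levi-Civita connection of `g`: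
`∇_{∂ᵢ} ∂ⱼ = ∑ₖ Γᵏᵢⱼ ∂ₖ`. -/
def christoffel {m : ℕ} (g : (Fin m → ℝ) → Matrix (Fin m) (Fin m) ℝ)
    (k i j : Fin m) (x : Fin m → ℝ) : ℝ :=
  (1 / 2) * ∑ l, (g x)⁻¹ k l *
    (pderiv i (fun y => g y j l) x + pderiv j (fun y => g y i l) x
      - pderiv l (fun y => g y i j) x)

/-- The component `Rˡᵢⱼₖ` of the Riemann curvature tensor
`R(X, Y)Z = ∇_X ∇_Y Z - ∇_Y ∇_X Z - ∇_{[X, Y]} Z`, with `R(∂ᵢ, ∂ⱼ)∂ₖ = ∑ₗ Rˡᵢⱼₖ ∂ₗ`. -/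
def riemann {m : ℕ} (g : (Fin m → ℝ) → Matrix (Fin m) (Fin m) ℝ)
    (l i j k : Fin m) (x : Fin m → ℝ) : ℝ :=
  pderiv i (christoffel g l j k) x - pderiv j (christoffel g l i k) x
    + ∑ a, (christoffel g a j k x * christoffel g l i a x
      - christoffel g a i k x * christoffel g l j a x)

/-- The Ricci tensor `Ric(∂ⱼ, ∂ₖ)`, the trace of `X ↦ R(X, ∂ⱼ)∂ₖ`. -/
def ricci {m : ℕ} (g : (Fin m → ℝ) → Matrix (Fin m) (Fin m) ℝ)
    (j k : Fin m) (x : Fin m → ℝ) : ℝ :=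
  ∑ i, riemann g i i j k x

/-- The scalar curvature `∑ g^{jk} Ric(∂ⱼ, ∂ₖ)`. Equivalently, for an orthonormal basis `A` of the
tangent space, `∑_{t,s} g(R(A_t, A_s)A_s, A_t)`. -/
def scalar {m : ℕ} (g : (Fin m → ℝ) → Matrix (Fin m) (Fin m) ℝ) (x : Fin m → ℝ) : ℝ :=
  ∑ j, ∑ k, (g x)⁻¹ j k * ricci g j k x

end RiemannCoord

namespace AlphaGeometry

/-- `𝒫ₙ`: the strictly positive probability distributions on `n` points. -/
def P (n : ℕ) : Set (Fin n → ℝ) :=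
  {θ | (∀ k, 0 < θ k) ∧ ∑ k, θ k = 1}

/-- The map `φ_{α,n}`. -/
def phi (α : ℝ) (n : ℕ) (θ : Fin n → ℝ) : Fin n → ℝ := fun k =>
  if α = 1 then Real.log (θ k) else 2 / (1 - α) * θ k ^ ((1 - α) / 2)

/-- The global chart `(θ₁, …, θ_{m+1}) ↦ (θ₁, …, θ_m)` of the `m`-dimensional manifold
`𝒫_{m+1}`. -/
def chart {m : ℕ} (θ : Fin (m + 1) → ℝ) : Fin m → ℝ := fun i => θ i.castSucc

/-- The inverse `(x₁, …, x_m) ↦ (x₁, …, x_m, 1 - ∑ xᵢ)` of the global chart. -/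
def param {m : ℕ} (x : Fin m → ℝ) : Fin (m + 1) → ℝ :=
  Fin.snoc (α := fun _ => ℝ) x (1 - ∑ i, x i)

theorem param_chart {m : ℕ} {θ : Fin (m + 1) → ℝ} (hθ : θ ∈ P (m + 1)) :
    param (chart θ) = θ := by
  have h := hθ.2
  rw [Fin.sum_univ_castSucc] at h
  funext k
  refine Fin.lastCases ?_ (fun i => ?_) k
  · simp only [param, chart, Fin.snoc_last]
    linarith
  · simp [param, chart]

/-- The metric `g_α` of `𝒫_{m+1}` in the global chart: the pull-back of the canonical metric of
`ℝ^{m+1}` along `φ_α`. -/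
def metric (α : ℝ) (m : ℕ) : (Fin m → ℝ) → Matrix (Fin m) (Fin m) ℝ :=
  RiemannCoord.pullbackMetric fun x => phi α (m + 1) (param x)

/-- The scalar curvature of `(𝒫_{m+1}, g_α)` at the point `θ`. -/
def Scal (α : ℝ) {m : ℕ} (θ : Fin (m + 1) → ℝ) : ℝ :=
  RiemannCoord.scalar (metric α m) (chart θ)

end AlphaGeometry

end

/-! The image of `φ_α` is a surface in `ℝ³`, so its curvature follows from the Gauss equation
`g(R(∂ᵢ, ∂ⱼ)∂ₖ, ∂ₚ) = ⟨II(∂ⱼ, ∂ₖ), II(∂ᵢ, ∂ₚ)⟩ - ⟨II(∂ᵢ, ∂ₖ), II(∂ⱼ, ∂ₚ)⟩`. For a surface with a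
(not necessarily unit) normal `ν` and second fundamental form `h = ⟨∂ᵢ∂ⱼF, ν⟩`, taking traces gives
`Scal = 2 det h / (det g · |ν|²)`.

The map `φ_α` applies one function `f` to every coordinate. The tangent vectors `∂ᵢ` of the simplex
have coordinate sum `0`, so `ν = (1 / f'(θₖ))ₖ` is normal to the image, and `g` and `h` are the
restrictions to the simplex of the diagonal forms `∑ f'(θₖ)² dθₖ²` and `∑ (f''(θₖ) / f'(θₖ)) dθₖ²`.
Here `f'(t)² = t^{-(α+1)}` and `f''(t) / f'(t) = -(α+1) / (2t)`, while the restriction of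
`∑ aₖ dθₖ²` has determinant `a₁a₂ + a₂a₃ + a₃a₁`. For `aₖ = 1 / θₖ` this is `1 / (θ₁θ₂θ₃)` because
`∑ θₖ = 1`. -/

open Filter Topology

namespace RiemannCoord

section PartialDerivatives

variable {m : ℕ} {E : Type*} [NormedAddCommGroup E] [NormedSpace ℝ E]
  {F G : (Fin m → ℝ) → E} {x : Fin m → ℝ}

theorem pderiv_congr (h : F =ᶠ[𝓝 x] G) (i : Fin m) : pderiv i F x = pderiv i G x := by
  rw [pderiv, pderiv, h.fderiv_eq]

theorem contDiffAt_pderiv {k : WithTop ℕ∞} (hF : ContDiffAt ℝ (k + 1) F x) (i : Fin m) :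
    ContDiffAt ℝ k (pderiv i F) x :=
  hF.fderiv_right_succ.clm_apply contDiffAt_const

theorem differentiableAt_pderiv (hF : ContDiffAt ℝ 2 F x) (i : Fin m) :
    DifferentiableAt ℝ (pderiv i F) x :=
  (contDiffAt_pderiv (k := 1) (by rwa [one_add_one_eq_two]) i).differentiableAt one_ne_zero

theorem pderiv_comm (hF : ContDiffAt ℝ 2 F x) (i j : Fin m) :
    pderiv i (pderiv j F) x = pderiv j (pderiv i F) x := by
  have hdiff : DifferentiableAt ℝ (fderiv ℝ F) x :=
    (hF.fderiv_right (m := 1) one_add_one_eq_two.le).differentiableAt one_ne_zero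
  have pderiv_pderiv (i j : Fin m) : pderiv i (pderiv j F) x =
      fderiv ℝ (fderiv ℝ F) x (Pi.single i 1) (Pi.single j 1) := by
    change fderiv ℝ (fun y => fderiv ℝ F y (Pi.single j 1)) x (Pi.single i 1) = _
    rw [fderiv_clm_apply hdiff (differentiableAt_const _)]
    simp
  rw [pderiv_pderiv, pderiv_pderiv, (hF.isSymmSndFDerivAt (by simp)).eq]

theorem pderiv_apply {n : ℕ} {F : (Fin m → ℝ) → (Fin n → ℝ)} (hF : DifferentiableAt ℝ F x)
    (i : Fin m) (k : Fin n) : pderiv i F x k = pderiv i (fun y => F y k) x := by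
  rw [pderiv, pderiv, fderiv_apply hF]
  rfl

theorem differentiableAt_dotProduct {n : ℕ} {u v : (Fin m → ℝ) → (Fin n → ℝ)}
    (hu : DifferentiableAt ℝ u x) (hv : DifferentiableAt ℝ v x) :
    DifferentiableAt ℝ (fun y => u y ⬝ᵥ v y) x := by
  simp only [dotProduct]
  fun_prop

theorem pderiv_dotProduct {n : ℕ} {u v : (Fin m → ℝ) → (Fin n → ℝ)}
    (hu : DifferentiableAt ℝ u x) (hv : DifferentiableAt ℝ v x) (i : Fin m) :
    pderiv i (fun y => u y ⬝ᵥ v y) x = pderiv i u x ⬝ᵥ v x + u x ⬝ᵥ pderiv i v x := by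
  have hu' := differentiableAt_pi.1 hu
  have hv' := differentiableAt_pi.1 hv
  simp only [dotProduct, ← Finset.sum_add_distrib, pderiv_apply hu, pderiv_apply hv]
  rw [pderiv, fderiv_fun_sum fun k _ => (hu' k).fun_mul (hv' k), sum_apply]
  refine Finset.sum_congr rfl fun k _ => ?_
  rw [fderiv_fun_mul (hu' k) (hv' k)]
  simp only [pderiv, add_apply, smul_apply, smul_eq_mul]
  ring

end PartialDerivatives

open Matrix

section MatrixInverse

variable {E ι : Type*} [NormedAddCommGroup E] [NormedSpace ℝ E] [Fintype ι] [DecidableEq ι]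
  {A : E → Matrix ι ι ℝ} {x : E}

theorem differentiableAt_det (hA : ∀ i j, DifferentiableAt ℝ (fun y => A y i j) x) :
    DifferentiableAt ℝ (fun y => (A y).det) x := by
  simp only [det_apply]
  fun_prop

theorem differentiableAt_inv_apply (hA : ∀ i j, DifferentiableAt ℝ (fun y => A y i j) x)
    (hdet : (A x).det ≠ 0) (i j : ι) : DifferentiableAt ℝ (fun y => (A y)⁻¹ i j) x := by
  have hadj : DifferentiableAt ℝ (fun y => (A y).adjugate i j) x := by
    simp only [adjugate_apply]
    refine differentiableAt_det fun k l => ?_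
    simp only [updateRow_apply]
    split_ifs <;> fun_prop
  simp only [inv_def, Ring.inverse_eq_inv', Matrix.smul_apply, smul_eq_mul]
  exact ((differentiableAt_det hA).fun_inv hdet).mul hadj

end MatrixInverse

section GaussEquation

variable {m n : ℕ} {F : (Fin m → ℝ) → (Fin n → ℝ)} {x : Fin m → ℝ}

theorem pullbackMetric_apply (F : (Fin m → ℝ) → (Fin n → ℝ)) (x : Fin m → ℝ) (i j : Fin m) :
    pullbackMetric F x i j = pderiv i F x ⬝ᵥ pderiv j F x :=
  rfl

theorem pderiv_pullbackMetric (hF : ContDiffAt ℝ 2 F x) (k i j : Fin m) :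
    pderiv k (fun y => pullbackMetric F y i j) x =
      pderiv k (pderiv i F) x ⬝ᵥ pderiv j F x + pderiv i F x ⬝ᵥ pderiv k (pderiv j F) x :=
  pderiv_dotProduct (differentiableAt_pderiv hF i) (differentiableAt_pderiv hF j) k

theorem differentiableAt_pullbackMetric (hF : ContDiffAt ℝ 2 F x) (i j : Fin m) :
    DifferentiableAt ℝ (fun y => pullbackMetric F y i j) x :=
  differentiableAt_dotProduct (differentiableAt_pderiv hF i) (differentiableAt_pderiv hF j)

theorem christoffel_pullbackMetric (hF : ContDiffAt ℝ 2 F x) (k i j : Fin m) :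
    christoffel (pullbackMetric F) k i j x =
      ((pullbackMetric F x)⁻¹ *ᵥ fun l => pderiv i (pderiv j F) x ⬝ᵥ pderiv l F x) k := by
  rw [christoffel, mulVec, dotProduct, Finset.mul_sum]
  refine Finset.sum_congr rfl fun l _ => ?_
  simp only [pderiv_pullbackMetric hF]
  rw [pderiv_comm hF j i, pderiv_comm hF l i, pderiv_comm hF l j,
    dotProduct_comm (pderiv j F x), dotProduct_comm (pderiv i F x) (pderiv j (pderiv l F) x)]
  ring

theorem pullbackMetric_mulVec_christoffel (hF : ContDiffAt ℝ 2 F x)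
    (hdet : (pullbackMetric F x).det ≠ 0) (i j : Fin m) :
    (pullbackMetric F x *ᵥ fun l => christoffel (pullbackMetric F) l i j x) =
      fun l => pderiv i (pderiv j F) x ⬝ᵥ pderiv l F x := by
  rw [funext fun l => christoffel_pullbackMetric hF l i j, mulVec_mulVec,
    mul_nonsing_inv _ hdet.isUnit, one_mulVec]

theorem eventually_pullbackMetric_mulVec_christoffel (hF : ContDiffAt ℝ 2 F x)
    (hdet : (pullbackMetric F x).det ≠ 0) (i j : Fin m) :
    ∀ᶠ y in 𝓝 x, (pullbackMetric F y *ᵥ fun l => christoffel (pullbackMetric F) l i j y) =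
      fun l => pderiv i (pderiv j F) y ⬝ᵥ pderiv l F y := by
  filter_upwards [hF.eventually (by simp), (differentiableAt_det
    (differentiableAt_pullbackMetric hF)).continuousAt.eventually_ne hdet] with y hy hdety
  exact pullbackMetric_mulVec_christoffel hy hdety i j

theorem differentiableAt_christoffel_pullbackMetric (hF : ContDiffAt ℝ 3 F x)
    (hdet : (pullbackMetric F x).det ≠ 0) (k i j : Fin m) :
    DifferentiableAt ℝ (christoffel (pullbackMetric F) k i j) x := by
  have hF₂ : ContDiffAt ℝ 2 F x := hF.of_le (by norm_num)
  have hinv : DifferentiableAt ℝ (fun y => (pullbackMetric F y)⁻¹ k) x :=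
    differentiableAt_pi.2 (differentiableAt_inv_apply (differentiableAt_pullbackMetric hF₂) hdet k)
  have hij : DifferentiableAt ℝ (pderiv i (pderiv j F)) x :=
    differentiableAt_pderiv (contDiffAt_pderiv (by rwa [two_add_one_eq_three]) j) i
  have hlowered : DifferentiableAt ℝ
      (fun y l => pderiv i (pderiv j F) y ⬝ᵥ pderiv l F y) x :=
    differentiableAt_pi.2 fun l => differentiableAt_dotProduct hij (differentiableAt_pderiv hF₂ l)
  exact (differentiableAt_dotProduct hinv hlowered).congr_of_eventuallyEq <|
    (hF₂.eventually (by simp)).mono fun y hy => christoffel_pullbackMetric hy k i j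

/-- The second fundamental form `II(∂ᵢ, ∂ⱼ) = ∂ᵢ∂ⱼF - ∑ₖ Γᵏᵢⱼ ∂ₖF` of the immersion `F`, as a
vector of the ambient space. -/
noncomputable def secondFundamentalForm (F : (Fin m → ℝ) → (Fin n → ℝ)) (i j : Fin m)
    (x : Fin m → ℝ) : Fin n → ℝ :=
  pderiv i (pderiv j F) x - ∑ k, christoffel (pullbackMetric F) k i j x • pderiv k F x

theorem secondFundamentalForm_dotProduct (i j : Fin m) (v : Fin n → ℝ) :
    secondFundamentalForm F i j x ⬝ᵥ v = pderiv i (pderiv j F) x ⬝ᵥ v -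
      ∑ k, christoffel (pullbackMetric F) k i j x * (pderiv k F x ⬝ᵥ v) := by
  simp only [secondFundamentalForm, sub_dotProduct, sum_dotProduct, smul_dotProduct, smul_eq_mul]

theorem secondFundamentalForm_dotProduct_pderiv (hF : ContDiffAt ℝ 2 F x)
    (hdet : (pullbackMetric F x).det ≠ 0) (i j l : Fin m) :
    secondFundamentalForm F i j x ⬝ᵥ pderiv l F x = 0 := by
  rw [secondFundamentalForm_dotProduct, sub_eq_zero,
    ← congrFun (pullbackMetric_mulVec_christoffel hF hdet i j) l, mulVec, dotProduct]
  simp only [pullbackMetric_apply, dotProduct_comm (pderiv l F x), mul_comm]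

theorem secondFundamentalForm_dotProduct_self (hF : ContDiffAt ℝ 2 F x)
    (hdet : (pullbackMetric F x).det ≠ 0) (i j k l : Fin m) :
    secondFundamentalForm F i j x ⬝ᵥ secondFundamentalForm F k l x =
      secondFundamentalForm F i j x ⬝ᵥ pderiv k (pderiv l F) x := by
  rw [dotProduct_comm, secondFundamentalForm_dotProduct k l, dotProduct_comm]
  simp only [dotProduct_comm (pderiv _ F x), secondFundamentalForm_dotProduct_pderiv hF hdet,
    mul_zero, Finset.sum_const_zero, sub_zero]

theorem pullbackMetric_mulVec_pderiv_christoffel (hF : ContDiffAt ℝ 3 F x)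
    (hdet : (pullbackMetric F x).det ≠ 0) (i j k p : Fin m) :
    (pullbackMetric F x *ᵥ fun l => pderiv i (christoffel (pullbackMetric F) l j k) x) p =
      pderiv i (pderiv j (pderiv k F)) x ⬝ᵥ pderiv p F x
        + secondFundamentalForm F j k x ⬝ᵥ pderiv i (pderiv p F) x
        - ∑ l, christoffel (pullbackMetric F) l j k x *
          (pderiv i (pderiv l F) x ⬝ᵥ pderiv p F x) := by
  have hF₂ : ContDiffAt ℝ 2 F x := hF.of_le (by norm_num)
  have hjk : DifferentiableAt ℝ (pderiv j (pderiv k F)) x :=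
    differentiableAt_pderiv (contDiffAt_pderiv (by rwa [two_add_one_eq_three]) k) j
  have hg : DifferentiableAt ℝ (fun y => pullbackMetric F y p) x :=
    differentiableAt_pi.2 (differentiableAt_pullbackMetric hF₂ p)
  have hΓ : DifferentiableAt ℝ (fun y l => christoffel (pullbackMetric F) l j k y) x :=
    differentiableAt_pi.2 fun l => differentiableAt_christoffel_pullbackMetric hF hdet l j k
  -- Lowering the upper index before differentiating avoids the derivative of `g⁻¹`.
  have hlowered : (fun y => pullbackMetric F y p ⬝ᵥ
      fun l => christoffel (pullbackMetric F) l j k y) =ᶠ[𝓝 x]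
      fun y => pderiv j (pderiv k F) y ⬝ᵥ pderiv p F y :=
    (eventually_pullbackMetric_mulVec_christoffel hF₂ hdet j k).mono fun y hy => congrFun hy p
  have hderiv := pderiv_congr hlowered i
  rw [pderiv_dotProduct hg hΓ, pderiv_dotProduct hjk (differentiableAt_pderiv hF₂ p)] at hderiv
  have hg' : pderiv i (fun y => pullbackMetric F y p) x = fun l =>
      pderiv l F x ⬝ᵥ pderiv i (pderiv p F) x + pderiv i (pderiv l F) x ⬝ᵥ pderiv p F x := by
    funext l
    rw [pderiv_apply hg, pderiv_pullbackMetric hF₂, dotProduct_comm,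
      dotProduct_comm (pderiv p F x)]
  have hΓ' : pderiv i (fun y l => christoffel (pullbackMetric F) l j k y) x =
      fun l => pderiv i (christoffel (pullbackMetric F) l j k) x :=
    funext fun l => pderiv_apply hΓ i l
  rw [hg', hΓ', ← eq_sub_iff_add_eq'] at hderiv
  rw [mulVec, hderiv, secondFundamentalForm_dotProduct, dotProduct_comm (fun l => _ + _)]
  conv_lhs => enter [2]; rw [dotProduct]
  simp only [mul_add, Finset.sum_add_distrib]
  ring

theorem pullbackMetric_mulVec_riemann (hF : ContDiffAt ℝ 3 F x)
    (hdet : (pullbackMetric F x).det ≠ 0) (i j k p : Fin m) :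
    (pullbackMetric F x *ᵥ fun l => riemann (pullbackMetric F) l i j k x) p =
      secondFundamentalForm F j k x ⬝ᵥ secondFundamentalForm F i p x
        - secondFundamentalForm F i k x ⬝ᵥ secondFundamentalForm F j p x := by
  have hF₂ : ContDiffAt ℝ 2 F x := hF.of_le (by norm_num)
  have hthird : pderiv i (pderiv j (pderiv k F)) x = pderiv j (pderiv i (pderiv k F)) x :=
    pderiv_comm (contDiffAt_pderiv (by rwa [two_add_one_eq_three]) k) i j
  have hquadratic (i j : Fin m) : (pullbackMetric F x *ᵥ fun l =>
      ∑ a, christoffel (pullbackMetric F) a j k x * christoffel (pullbackMetric F) l i a x) p =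
      ∑ a, christoffel (pullbackMetric F) a j k x *
        (pderiv i (pderiv a F) x ⬝ᵥ pderiv p F x) := by
    have hlowered (a : Fin m) := congrFun (pullbackMetric_mulVec_christoffel hF₂ hdet i a) p
    simp only [mulVec, dotProduct] at hlowered ⊢
    simp only [← hlowered, Finset.mul_sum]
    rw [Finset.sum_comm]
    exact Finset.sum_congr rfl fun a _ => Finset.sum_congr rfl fun l _ => mul_left_comm _ _ _
  have hsplit : (fun l => riemann (pullbackMetric F) l i j k x) =
      (fun l => pderiv i (christoffel (pullbackMetric F) l j k) x)
        - (fun l => pderiv j (christoffel (pullbackMetric F) l i k) x)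
        + ((fun l => ∑ a, christoffel (pullbackMetric F) a j k x *
            christoffel (pullbackMetric F) l i a x)
          - fun l => ∑ a, christoffel (pullbackMetric F) a i k x *
            christoffel (pullbackMetric F) l j a x) := by
    funext l
    simp only [riemann, Finset.sum_sub_distrib, Pi.add_apply, Pi.sub_apply]
  rw [hsplit, mulVec_add, mulVec_sub, mulVec_sub]
  simp only [Pi.add_apply, Pi.sub_apply, hquadratic,
    pullbackMetric_mulVec_pderiv_christoffel hF hdet,
    secondFundamentalForm_dotProduct_self hF₂ hdet, hthird]
  ring

theorem scalar_pullbackMetric (hF : ContDiffAt ℝ 3 F x) (hdet : (pullbackMetric F x).det ≠ 0) :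
    scalar (pullbackMetric F) x =
      ∑ j, ∑ k, ∑ i, ∑ p, (pullbackMetric F x)⁻¹ j k * (pullbackMetric F x)⁻¹ i p *
        (secondFundamentalForm F j k x ⬝ᵥ secondFundamentalForm F i p x
          - secondFundamentalForm F i k x ⬝ᵥ secondFundamentalForm F j p x) := by
  have hraise (i j k : Fin m) : riemann (pullbackMetric F) i i j k x =
      ∑ p, (pullbackMetric F x)⁻¹ i p *
        (secondFundamentalForm F j k x ⬝ᵥ secondFundamentalForm F i p x
          - secondFundamentalForm F i k x ⬝ᵥ secondFundamentalForm F j p x) := by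
    simp only [← pullbackMetric_mulVec_riemann hF hdet]
    change _ = ((pullbackMetric F x)⁻¹ *ᵥ
      (pullbackMetric F x *ᵥ fun l => riemann (pullbackMetric F) l i j k x)) i
    rw [mulVec_mulVec, nonsing_inv_mul _ hdet.isUnit, one_mulVec]
  simp only [scalar, ricci, hraise, Finset.mul_sum, mul_assoc]

end GaussEquation

section Trace

variable {R : Type*} [CommRing R]

theorem trace_sq_sub_trace_sq {ι : Type*} [Fintype ι] [DecidableEq ι] (A : Matrix ι ι R)
    {B : Matrix ι ι R} (hB : B.IsSymm) :
    (A * B).trace ^ 2 - ((A * B) ^ 2).trace =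
      ∑ j, ∑ k, ∑ i, ∑ p, A j k * A i p * (B j k * B i p - B i k * B j p) := by
  have htrace_sq : (A * B).trace ^ 2 =
      ∑ j, ∑ k, ∑ i, ∑ p, A j k * B k j * (A i p * B p i) := by
    simp only [sq, trace, diag_apply, mul_apply, Finset.sum_mul]
    simp only [Finset.mul_sum]
  have hsq_trace : ((A * B) ^ 2).trace =
      ∑ j, ∑ k, ∑ i, ∑ p, A j k * B k i * (A i p * B p j) := by
    simp only [sq, trace, diag_apply, mul_apply, Finset.sum_mul_sum]
    exact Finset.sum_congr rfl fun j _ => Finset.sum_comm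
  simp only [htrace_sq, hsq_trace, ← Finset.sum_sub_distrib]
  refine Finset.sum_congr rfl fun j _ => Finset.sum_congr rfl fun k _ =>
    Finset.sum_congr rfl fun i _ => Finset.sum_congr rfl fun p _ => ?_
  rw [hB.apply j k, hB.apply i p, hB.apply i k, hB.apply j p]
  ring

theorem trace_sq_sub_trace_sq_fin_two (A : Matrix (Fin 2) (Fin 2) R) :
    A.trace ^ 2 - (A ^ 2).trace = 2 * A.det := by
  rw [sq A, trace_fin_two, trace_fin_two, det_fin_two]
  simp only [mul_apply, Fin.sum_univ_two]
  ring

end Trace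

section Hypersurface

variable {m : ℕ} {F : (Fin m → ℝ) → (Fin (m + 1) → ℝ)} {x : Fin m → ℝ} {ν : Fin (m + 1) → ℝ}

theorem exists_smul_eq_of_dotProduct_pderiv_eq_zero (hdet : (pullbackMetric F x).det ≠ 0)
    (hν : ν ≠ 0) (hνF : ∀ a, pderiv a F x ⬝ᵥ ν = 0) {v : Fin (m + 1) → ℝ}
    (hvF : ∀ a, pderiv a F x ⬝ᵥ v = 0) : ∃ c : ℝ, c • ν = v := by
  let J : Matrix (Fin m) (Fin (m + 1)) ℝ := of fun a => pderiv a F x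
  have hrank : J.rank = m := by
    rw [← rank_self_mul_transpose, show J * Jᵀ = pullbackMetric F x from rfl,
      rank_of_isUnit _ ((isUnit_iff_isUnit_det _).2 hdet.isUnit), Fintype.card_fin]
  have hker : Module.finrank ℝ J.mulVecLin.ker = 1 := by
    have := J.mulVecLin.finrank_range_add_finrank_ker
    rw [← rank, hrank, Module.finrank_fin_fun] at this
    lia
  obtain ⟨c, hc⟩ := (finrank_eq_one_iff_of_nonzero' (⟨ν, funext hνF⟩ : J.mulVecLin.ker)
    (Subtype.coe_ne_coe.1 hν)).1 hker ⟨v, funext hvF⟩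
  exact ⟨c, congrArg Subtype.val hc⟩

/-- The second fundamental form of a hypersurface `F` with respect to a normal vector `ν`, which
need not be of unit length. -/
noncomputable def scalarSecondFundamentalForm (F : (Fin m → ℝ) → (Fin (m + 1) → ℝ))
    (ν : Fin (m + 1) → ℝ) (x : Fin m → ℝ) : Matrix (Fin m) (Fin m) ℝ :=
  of fun i j => pderiv i (pderiv j F) x ⬝ᵥ ν

theorem secondFundamentalForm_dotProduct_of_normal (hF : ContDiffAt ℝ 2 F x)
    (hdet : (pullbackMetric F x).det ≠ 0) (hν : ν ≠ 0) (hνF : ∀ a, pderiv a F x ⬝ᵥ ν = 0)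
    (i j k l : Fin m) :
    secondFundamentalForm F i j x ⬝ᵥ secondFundamentalForm F k l x =
      scalarSecondFundamentalForm F ν x i j * scalarSecondFundamentalForm F ν x k l / (ν ⬝ᵥ ν) := by
  have hnormal (i j : Fin m) :
      secondFundamentalForm F i j x ⬝ᵥ ν = scalarSecondFundamentalForm F ν x i j := by
    simp only [secondFundamentalForm_dotProduct, hνF, mul_zero, Finset.sum_const_zero, sub_zero,
      scalarSecondFundamentalForm, of_apply]
  have hparallel (i j : Fin m) : ∃ c : ℝ, c • ν = secondFundamentalForm F i j x :=
    exists_smul_eq_of_dotProduct_pderiv_eq_zero hdet hν hνF fun a =>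
      (dotProduct_comm _ _).trans (secondFundamentalForm_dotProduct_pderiv hF hdet i j a)
  obtain ⟨a, ha⟩ := hparallel i j
  obtain ⟨b, hb⟩ := hparallel k l
  have hνν : ν ⬝ᵥ ν ≠ 0 := mt dotProduct_self_eq_zero.1 hν
  rw [← hnormal, ← hnormal, ← ha, ← hb]
  simp only [smul_dotProduct, dotProduct_smul, smul_eq_mul]
  field_simp

theorem scalar_pullbackMetric_hypersurface (hF : ContDiffAt ℝ 3 F x)
    (hdet : (pullbackMetric F x).det ≠ 0) (hν : ν ≠ 0) (hνF : ∀ a, pderiv a F x ⬝ᵥ ν = 0) :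
    scalar (pullbackMetric F) x =
      (((pullbackMetric F x)⁻¹ * scalarSecondFundamentalForm F ν x).trace ^ 2 -
        (((pullbackMetric F x)⁻¹ * scalarSecondFundamentalForm F ν x) ^ 2).trace) / (ν ⬝ᵥ ν) := by
  have hF₂ : ContDiffAt ℝ 2 F x := hF.of_le (by norm_num)
  have hsymm : (scalarSecondFundamentalForm F ν x).IsSymm :=
    IsSymm.ext fun i j => congrArg (· ⬝ᵥ ν) (pderiv_comm hF₂ j i)
  rw [scalar_pullbackMetric hF hdet]
  simp only [secondFundamentalForm_dotProduct_of_normal hF₂ hdet hν hνF]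
  rw [trace_sq_sub_trace_sq _ hsymm]
  simp only [Finset.sum_div]
  refine Finset.sum_congr rfl fun j _ => Finset.sum_congr rfl fun k _ =>
    Finset.sum_congr rfl fun i _ => Finset.sum_congr rfl fun p _ => ?_
  ring

end Hypersurface

theorem scalar_pullbackMetric_surface {F : (Fin 2 → ℝ) → (Fin 3 → ℝ)} {x : Fin 2 → ℝ}
    {ν : Fin 3 → ℝ} (hF : ContDiffAt ℝ 3 F x) (hdet : (pullbackMetric F x).det ≠ 0) (hν : ν ≠ 0)
    (hνF : ∀ a, pderiv a F x ⬝ᵥ ν = 0) :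
    scalar (pullbackMetric F) x = 2 * (scalarSecondFundamentalForm F ν x).det /
      ((pullbackMetric F x).det * (ν ⬝ᵥ ν)) := by
  rw [scalar_pullbackMetric_hypersurface hF hdet hν hνF, trace_sq_sub_trace_sq_fin_two, det_mul,
    det_nonsing_inv, Ring.inverse_eq_inv']
  field_simp

end RiemannCoord

namespace AlphaGeometry

open Matrix RiemannCoord

section SeparableEmbedding

variable {m : ℕ} {f : ℝ → ℝ} {x : Fin m → ℝ}

/-- The coordinate vector field `∂ᵢ = eᵢ - e_{m+1}` of the global chart, as a vector of
`ℝ^{m+1}`. -/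
def coordVector (i : Fin m) : Fin (m + 1) → ℝ :=
  Pi.single i.castSucc 1 - Pi.single (Fin.last m) 1

theorem sum_coordVector (i : Fin m) : ∑ k, coordVector i k = 0 := by
  simp [coordVector]

theorem contDiff_param_apply {r : WithTop ℕ∞} (k : Fin (m + 1)) :
    ContDiff ℝ r fun y : Fin m → ℝ => param y k := by
  induction k using Fin.lastCases with
  | last => simp only [param, Fin.snoc_last]; fun_prop
  | cast k => simp only [param, Fin.snoc_castSucc]; fun_prop

theorem pderiv_param_apply (i : Fin m) (k : Fin (m + 1)) (x : Fin m → ℝ) :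
    pderiv i (fun y => param y k) x = coordVector i k := by
  induction k using Fin.lastCases with
  | last =>
    simp only [param, Fin.snoc_last, pderiv]
    rw [fderiv_const_sub, fderiv_fun_sum fun _ _ => by fun_prop]
    simp [coordVector, fderiv_apply, Pi.single_apply]
  | cast k =>
    simp only [param, Fin.snoc_castSucc, pderiv]
    simp [coordVector, fderiv_apply, Pi.single_apply, eq_comm]

theorem pderiv_comp_param {f : Fin (m + 1) → ℝ → ℝ}
    (hf : ∀ k, DifferentiableAt ℝ (f k) (param x k)) (i : Fin m) :
    pderiv i (fun y k => f k (param y k)) x =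
      fun k => deriv (f k) (param x k) * coordVector i k := by
  have hparam (k : Fin (m + 1)) : DifferentiableAt ℝ (fun y : Fin m → ℝ => param y k) x :=
    (contDiff_param_apply k).differentiable one_ne_zero x
  have hcomp (k : Fin (m + 1)) : HasFDerivAt (fun y => f k (param y k))
      (deriv (f k) (param x k) • fderiv ℝ (fun y => param y k) x) x :=
    (hf k).hasDerivAt.comp_hasFDerivAt x (hparam k).hasFDerivAt
  funext k
  rw [pderiv_apply (differentiableAt_pi.2 fun k => (hcomp k).differentiableAt), pderiv,
    (hcomp k).fderiv, ← pderiv_param_apply i k x]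
  rfl

/-- The map `x ↦ (f(θ₁), …, f(θ_{m+1}))` of the global chart of `𝒫_{m+1}`, of which `φ_α` is an
instance. -/
def separableEmbedding (f : ℝ → ℝ) (x : Fin m → ℝ) : Fin (m + 1) → ℝ := fun k => f (param x k)

theorem contDiffAt_separableEmbedding {r : WithTop ℕ∞}
    (hf : ∀ k, ContDiffAt ℝ r f (param x k)) : ContDiffAt ℝ r (separableEmbedding f) x :=
  contDiffAt_pi.2 fun k => (hf k).comp x (contDiff_param_apply k).contDiffAt

theorem pderiv_separableEmbedding (hf : ∀ k, DifferentiableAt ℝ f (param x k)) (i : Fin m) :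
    pderiv i (separableEmbedding f) x = fun k => deriv f (param x k) * coordVector i k :=
  pderiv_comp_param hf i

theorem pderiv_pderiv_separableEmbedding (hf : ∀ k, ContDiffAt ℝ 2 f (param x k)) (i j : Fin m) :
    pderiv i (pderiv j (separableEmbedding f)) x =
      fun k => deriv (deriv f) (param x k) * coordVector j k * coordVector i k := by
  have hdiff : ∀ᶠ y in 𝓝 x, ∀ k, DifferentiableAt ℝ f (param y k) :=
    eventually_all.2 fun k =>
      (contDiff_param_apply (r := 0) k).continuous.continuousAt.eventually <|
        ((hf k).eventually (by simp)).mono fun t ht => ht.differentiableAt two_ne_zero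
  have hderiv (k : Fin (m + 1)) : DifferentiableAt ℝ (deriv f) (param x k) :=
    ((hf k).derivWithin (m := 1) one_add_one_eq_two.le).differentiableAt one_ne_zero
  have hfirst : pderiv j (separableEmbedding f) =ᶠ[𝓝 x]
      fun y k => deriv f (param y k) * coordVector j k :=
    hdiff.mono fun y hy => pderiv_separableEmbedding hy j
  rw [pderiv_congr hfirst, pderiv_comp_param fun k => (hderiv k).mul_const (coordVector j k)]
  simp only [deriv_mul_const_field]

/-- The Gram matrix of the vector fields `∂₁, …, ∂ₘ` for the diagonal bilinear form `∑ₖ aₖ dθₖ²`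
of `ℝ^{m+1}`. -/
def restrictedDiagonal (a : Fin (m + 1) → ℝ) : Matrix (Fin m) (Fin m) ℝ :=
  of fun i j => ∑ k, a k * coordVector i k * coordVector j k

theorem restrictedDiagonal_eq_diagonal_add (a : Fin (m + 1) → ℝ) :
    restrictedDiagonal a = diagonal (fun i => a i.castSucc) + of fun _ _ => a (Fin.last m) := by
  have hlast (i : Fin m) : Fin.last m ≠ i.castSucc := (Fin.castSucc_ne_last i).symm
  ext i j
  rcases eq_or_ne i j with rfl | hij
  · simp [restrictedDiagonal, coordVector, Fin.sum_univ_castSucc, Pi.single_apply, hlast]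
  · simp [restrictedDiagonal, coordVector, Fin.sum_univ_castSucc, Pi.single_apply, hlast, hij,
      hij.symm]

theorem det_restrictedDiagonal_two (a : Fin 3 → ℝ) :
    (restrictedDiagonal a).det = a 0 * a 1 + a 1 * a 2 + a 2 * a 0 := by
  rw [restrictedDiagonal_eq_diagonal_add, det_fin_two]
  change (a 0 + a 2) * (a 1 + a 2) - (0 + a 2) * (0 + a 2) = _
  ring

theorem pullbackMetric_separableEmbedding (hf : ∀ k, DifferentiableAt ℝ f (param x k)) :
    pullbackMetric (separableEmbedding f) x =
      restrictedDiagonal fun k => deriv f (param x k) ^ 2 := by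
  ext i j
  simp only [pullbackMetric_apply, pderiv_separableEmbedding hf, restrictedDiagonal, of_apply]
  exact Finset.sum_congr rfl fun k _ => by ring

theorem pderiv_separableEmbedding_dotProduct_inv_deriv (hf : ∀ k, DifferentiableAt ℝ f (param x k))
    (hf' : ∀ k, deriv f (param x k) ≠ 0) (i : Fin m) :
    pderiv i (separableEmbedding f) x ⬝ᵥ (fun k => (deriv f (param x k))⁻¹) = 0 := by
  rw [pderiv_separableEmbedding hf, ← sum_coordVector i]
  exact Finset.sum_congr rfl fun k _ => by field_simp [hf' k]

theorem scalarSecondFundamentalForm_separableEmbedding (hf : ∀ k, ContDiffAt ℝ 2 f (param x k)) :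
    scalarSecondFundamentalForm (separableEmbedding f) (fun k => (deriv f (param x k))⁻¹) x =
      restrictedDiagonal fun k => deriv (deriv f) (param x k) / deriv f (param x k) := by
  ext i j
  simp only [scalarSecondFundamentalForm, pderiv_pderiv_separableEmbedding hf, restrictedDiagonal,
    of_apply]
  exact Finset.sum_congr rfl fun k _ => by ring

end SeparableEmbedding

theorem scalar_separableEmbedding_surface {f : ℝ → ℝ} {x : Fin 2 → ℝ}
    (hf : ∀ k, ContDiffAt ℝ 3 f (param x k)) (hf' : ∀ k, deriv f (param x k) ≠ 0) :
    scalar (pullbackMetric (separableEmbedding f)) x =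
      2 * (restrictedDiagonal fun k => deriv (deriv f) (param x k) / deriv f (param x k)).det /
        ((restrictedDiagonal fun k => deriv f (param x k) ^ 2).det *
          ∑ k : Fin 3, (deriv f (param x k) ^ 2)⁻¹) := by
  have hf₂ (k : Fin 3) : ContDiffAt ℝ 2 f (param x k) := (hf k).of_le (by norm_num)
  have hf₁ (k : Fin 3) : DifferentiableAt ℝ f (param x k) := (hf₂ k).differentiableAt two_ne_zero
  have hdet : (pullbackMetric (separableEmbedding f) x).det ≠ 0 := by
    have hpos (k : Fin 3) : 0 < deriv f (param x k) ^ 2 := sq_pos_of_ne_zero (hf' k)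
    rw [pullbackMetric_separableEmbedding hf₁, det_restrictedDiagonal_two]
    have h₀ := hpos 0
    have h₁ := hpos 1
    have h₂ := hpos 2
    positivity
  have hν : (fun k => (deriv f (param x k))⁻¹) ≠ 0 := fun h => inv_ne_zero (hf' 0) (congrFun h 0)
  rw [scalar_pullbackMetric_surface (contDiffAt_separableEmbedding hf) hdet hν
    (pderiv_separableEmbedding_dotProduct_inv_deriv hf₁ hf'),
    scalarSecondFundamentalForm_separableEmbedding hf₂, pullbackMetric_separableEmbedding hf₁]
  simp only [dotProduct, ← sq, inv_pow]

section AlphaRepresentation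

variable {t : ℝ}

/-- The `α`-representation of a positive number: the function that `φ_α` applies to every
coordinate. -/
noncomputable def alphaRep (α t : ℝ) : ℝ :=
  if α = 1 then Real.log t else 2 / (1 - α) * t ^ ((1 - α) / 2)

theorem contDiffAt_alphaRep (α : ℝ) (ht : 0 < t) {r : WithTop ℕ∞} :
    ContDiffAt ℝ r (alphaRep α) t := by
  unfold alphaRep
  split_ifs
  · exact Real.contDiffAt_log.2 ht.ne'
  · exact contDiffAt_const.mul (Real.contDiffAt_rpow_const_of_ne ht.ne')

theorem deriv_alphaRep (α : ℝ) (ht : 0 < t) : deriv (alphaRep α) t = t ^ (-(α + 1) / 2) := by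
  rcases eq_or_ne α 1 with rfl | hα
  · have hrep : alphaRep 1 = Real.log := funext fun s => if_pos rfl
    rw [hrep, Real.deriv_log, ← Real.rpow_neg_one]
    norm_num
  · have hrep : alphaRep α = fun s => 2 / (1 - α) * s ^ ((1 - α) / 2) :=
      funext fun s => if_neg hα
    have hne : 1 - α ≠ 0 := sub_ne_zero.2 hα.symm
    rw [hrep, ((Real.hasDerivAt_rpow_const (Or.inl ht.ne')).const_mul _).deriv,
      show (1 - α) / 2 - 1 = -(α + 1) / 2 by ring]
    field_simp

theorem deriv_alphaRep_sq (α : ℝ) (ht : 0 < t) : deriv (alphaRep α) t ^ 2 = (t ^ (α + 1))⁻¹ := by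
  rw [deriv_alphaRep α ht, ← Real.rpow_mul_natCast ht.le, ← Real.rpow_neg ht.le]
  congr 1
  push_cast
  ring

theorem deriv_deriv_alphaRep_div (α : ℝ) (ht : 0 < t) :
    deriv (deriv (alphaRep α)) t / deriv (alphaRep α) t = -(α + 1) / 2 / t := by
  have hderiv : deriv (alphaRep α) =ᶠ[𝓝 t] fun s => s ^ (-(α + 1) / 2) :=
    (eventually_gt_nhds ht).mono fun s hs => deriv_alphaRep α hs
  rw [hderiv.deriv_eq, hderiv.eq_of_nhds,
    (Real.hasDerivAt_rpow_const (Or.inl ht.ne')).deriv, Real.rpow_sub_one ht.ne',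
    ← mul_div_assoc, div_right_comm, mul_div_cancel_right₀ _ (Real.rpow_pos_of_pos ht _).ne']

theorem Scal_eq_det_div (α : ℝ) {θ : Fin 3 → ℝ} (hθ : θ ∈ P 3) :
    Scal α θ = 2 * (restrictedDiagonal fun k => -(α + 1) / 2 / θ k).det /
      ((restrictedDiagonal fun k => (θ k ^ (α + 1))⁻¹).det * ∑ k, θ k ^ (α + 1)) := by
  have hsmooth (k : Fin 3) : ContDiffAt ℝ 3 (alphaRep α) (param (chart θ) k) := by
    rw [param_chart hθ]
    exact contDiffAt_alphaRep α (hθ.1 k)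
  have hderiv (k : Fin 3) : deriv (alphaRep α) (param (chart θ) k) ≠ 0 := by
    rw [param_chart hθ, deriv_alphaRep α (hθ.1 k)]
    exact (Real.rpow_pos_of_pos (hθ.1 k) _).ne'
  refine (scalar_separableEmbedding_surface hsmooth hderiv).trans ?_
  simp only [param_chart hθ, deriv_deriv_alphaRep_div α (hθ.1 _), deriv_alphaRep_sq α (hθ.1 _),
    inv_inv]

end AlphaRepresentation

end AlphaGeometry

theorem mainTheorem2 (α : ℝ) (θ : Fin 3 → ℝ) (hθ : θ ∈ AlphaGeometry.P 3) :
    AlphaGeometry.Scal α θ =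
      (1 + α) ^ 2 / 2 *
        (θ 0 ^ α * θ 1 ^ α * θ 2 ^ α /
          (θ 0 ^ (α + 1) + θ 1 ^ (α + 1) + θ 2 ^ (α + 1)) ^ 2) := by
  have hθ₀ : 0 < θ 0 := hθ.1 0
  have hθ₁ : 0 < θ 1 := hθ.1 1
  have hθ₂ : 0 < θ 2 := hθ.1 2
  have hsum : θ 0 + θ 1 + θ 2 = 1 := (Fin.sum_univ_three θ).symm.trans hθ.2
  rw [AlphaGeometry.Scal_eq_det_div α hθ, AlphaGeometry.det_restrictedDiagonal_two,
    AlphaGeometry.det_restrictedDiagonal_two, Fin.sum_univ_three]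
  simp only [Real.rpow_add_one hθ₀.ne', Real.rpow_add_one hθ₁.ne', Real.rpow_add_one hθ₂.ne']
  field_simp
  linear_combination
    (1 + α) ^ 2 * (θ 0 * θ 0 ^ α + θ 1 * θ 1 ^ α + θ 2 * θ 2 ^ α) * hsum
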